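/- Let $K$ be a field, let $m,n\ge 3$ be integers, and let $G_1$ and $G_2$ be connected simple graphs on the vertex sets $[m]=\{1,\dots,m\}$ and $[n]=\{1,\dots,n\}$, respectively. Let $S=K[x_{ij} : 1\le i\le m,\ 1\le j\le n]$ be the polynomial ring with its standard grading, let $$J_{G_1,G_2}=\bigl(x_{ik}x_{j\ell}-x_{i\ell}x_{jk} \;:\; 1\le i<j\le m,\ 1\le k<\ell\le n,\ \{i,j\}\in E(G_1),\ \{k,\ell\}\in E(G_2)\bigr)\subset S$$ be the binomial edge ideal of the pair $(G_1,G_2)$, and let $R=S/J_{G_1,G_2}$ be the quotient, a standard graded $K$-algebra with graded maximal ideal $\mathfrak m$. A Koszul filtration of $R$ is a family $\mathcal F$ of ideals of $R$, each generated by linear forms, such that (i) $\mathcal F$ contains the zero ideal and $\mathfrak m$; and (ii) for every non-zero ideal $I\in\mathcal F$ there exists $J\in\mathcal F$ with $J\subseteq I$ such that $I/J$ is a cyclic $R$-module and its annihilator $J:I$ belongs to $\mathcal F$. The algebra $R$ is called c-universally Koszul if the set of all ideals of $R$ that are generated by subsets of the set of residue classes $\{\bar x_{ij}: 1\le i\le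 m,\ 1\le j\le n\}$ of the variables is a Koszul filtration of $R$. Then $R$ is c-universally Koszul if and only if both $G_1$ and $G_2$ are complete graphs. -/

import Mathlib

noncomputable section

namespace KoszulPairs

open scoped DirectSum

/-! ### The grading on the quotient of a graded algebra by a homogeneous ideal -/

section Quotient

variable {K S : Type*} [CommRing K] [CommRing S] [Algebra K S]

/-- The degree `i` component of `S ⧸ I` is the image of the degree `i` component of `S`. -/
def quotientGrading (𝒮 : ℕ → Submodule K S) (I : Ideal S) : ℕ → Submodule K (S ⧸ I) :=
  fun i => (𝒮 i).map (Ideal.Quotient.mkₐ K I).toLinearMap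

variable (𝒮 : ℕ → Submodule K S) [GradedAlgebra 𝒮] (I : Ideal S)

instance quotientGrading_gradedMonoid : SetLike.GradedMonoid (quotientGrading 𝒮 I) where
  one_mem := ⟨1, SetLike.GradedOne.one_mem, map_one (Ideal.Quotient.mkₐ K I)⟩
  mul_mem := by
    rintro i j _ _ ⟨a, ha, rfl⟩ ⟨b, hb, rfl⟩
    exact ⟨a * b, SetLike.GradedMul.mul_mem ha hb, map_mul (Ideal.Quotient.mkₐ K I) a b⟩

/-- Residue classes of homogeneous elements of degree `i`. -/
def componentMap (i : ℕ) : 𝒮 i →ₗ[K] quotientGrading 𝒮 I i :=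
  (Ideal.Quotient.mkₐ K I).toLinearMap.restrict fun _ hx => Submodule.mem_map_of_mem hx

/-- The homogeneous components of an element of `S`, reduced modulo `I`. -/
def componentsAlgHom : S →ₐ[K] ⨁ i, quotientGrading 𝒮 I i :=
  (DirectSum.toAlgebra K (fun i => 𝒮 i)
    (fun i => (DirectSum.lof K ℕ (fun i => quotientGrading 𝒮 I i) i).comp (componentMap 𝒮 I i))
    rfl
    (fun {i j} a b => by
      simp only [LinearMap.comp_apply, DirectSum.lof_eq_of, DirectSum.of_mul_of]
      exact congrArg (DirectSum.of (fun i => quotientGrading 𝒮 I i) (i + j))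
        (Subtype.ext (map_mul (Ideal.Quotient.mkₐ K I) (a : S) (b : S))))).comp
    (DirectSum.decomposeAlgEquiv 𝒮 : S →ₐ[K] ⨁ i, 𝒮 i)

theorem componentsAlgHom_of_mem {i : ℕ} {s : S} (hs : s ∈ 𝒮 i) :
    componentsAlgHom 𝒮 I s =
      DirectSum.of (fun i => quotientGrading 𝒮 I i) i
        ⟨Ideal.Quotient.mkₐ K I s, Submodule.mem_map_of_mem hs⟩ := by
  simp only [componentsAlgHom, AlgHom.comp_apply, AlgEquiv.coe_toAlgHom,
    DirectSum.decomposeAlgEquiv_apply, DirectSum.decompose_of_mem 𝒮 hs]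
  erw [DirectSum.toAddMonoid_of]
  rfl

variable {I}

theorem componentsAlgHom_eq_zero (hI : I.IsHomogeneous 𝒮) {s : S} (hs : s ∈ I) :
    componentsAlgHom 𝒮 I s = 0 := by
  classical
  rw [← DirectSum.sum_support_decompose 𝒮 s, map_sum]
  refine Finset.sum_eq_zero fun i _ => ?_
  rw [componentsAlgHom_of_mem 𝒮 I (SetLike.coe_mem _)]
  have h0 : (⟨Ideal.Quotient.mkₐ K I (DirectSum.decompose 𝒮 s i),
      Submodule.mem_map_of_mem (SetLike.coe_mem _)⟩ : quotientGrading 𝒮 I i) = 0 :=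
    Subtype.ext (Ideal.Quotient.eq_zero_iff_mem.mpr (hI i hs))
  rw [h0, map_zero]

/-- The quotient of a graded algebra by a homogeneous ideal is a graded algebra. -/
abbrev quotientGradedAlgebra (hI : I.IsHomogeneous 𝒮) : GradedAlgebra (quotientGrading 𝒮 I) :=
  GradedAlgebra.ofAlgHom _
    (Ideal.Quotient.liftₐ I (componentsAlgHom 𝒮 I) fun _ hs => componentsAlgHom_eq_zero 𝒮 hI hs)
    (by
      classical
      refine Ideal.Quotient.algHom_ext K (AlgHom.ext fun s => ?_)
      change DirectSum.coeAlgHom (quotientGrading 𝒮 I) (componentsAlgHom 𝒮 I s) =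
        Ideal.Quotient.mkₐ K I s
      conv_lhs => rw [← DirectSum.sum_support_decompose 𝒮 s]
      conv_rhs => rw [← DirectSum.sum_support_decompose 𝒮 s]
      simp only [map_sum]
      refine Finset.sum_congr rfl fun i _ => ?_
      rw [componentsAlgHom_of_mem 𝒮 I (SetLike.coe_mem _), DirectSum.coeAlgHom_of])
    (by
      rintro i ⟨_, s, hs, rfl⟩
      exact componentsAlgHom_of_mem 𝒮 I hs)

end Quotient

/-! ### Koszul filtrations and c-universally Koszul algebras -/

section Filtration

variable {K R : Type*} [CommRing K] [CommRing R] [Algebra K R]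

/-- A Koszul filtration of a (standard graded) `K`-algebra `R` with grading `𝒜` and graded maximal
ideal `𝔪 = ⨁_{i > 0} 𝒜 i`: a family `F` of ideals generated by linear forms, containing `0` and
`𝔪`, such that every nonzero `I ∈ F` contains some `J ∈ F` with `I / J` cyclic and
`J : I = Ann (I / J)` in `F`. -/
structure IsKoszulFiltration (𝒜 : ℕ → Submodule K R) [GradedAlgebra 𝒜] (F : Set (Ideal R)) :
    Prop where
  generated_by_linear_forms : ∀ I ∈ F, ∃ L : Set R, L ⊆ (𝒜 1 : Set R) ∧ I = Ideal.span L
  zero_mem : (⊥ : Ideal R) ∈ F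
  maximal_mem : (HomogeneousIdeal.irrelevant 𝒜).toIdeal ∈ F
  exists_cyclic : ∀ I ∈ F, I ≠ ⊥ → ∃ J ∈ F, J ≤ I ∧
    Module.IsPrincipal R (I ⧸ J.submoduleOf I) ∧ J.colon (I : Set R) ∈ F

/-- `R`, with grading `𝒜` and variables (algebra generators of degree one) `x`, is c-universally
Koszul if the set of all ideals generated by subsets of the variables is a Koszul filtration. -/
def IsCUniversallyKoszul {σ : Type*} (𝒜 : ℕ → Submodule K R) [GradedAlgebra 𝒜] (x : σ → R) :
    Prop :=
  IsKoszulFiltration 𝒜 {I : Ideal R | ∃ A : Set σ, I = Ideal.span (x '' A)}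

end Filtration

/-! ### The binomial edge ideal of a pair of graphs -/

section Pair

variable (K : Type*) [Field K] {m n : ℕ}

/-- The 2-minor `[i j | k l]` of the generic `m × n` matrix. -/
def minor (i j : Fin m) (k l : Fin n) : MvPolynomial (Fin m × Fin n) K :=
  MvPolynomial.X (i, k) * MvPolynomial.X (j, l) - MvPolynomial.X (i, l) * MvPolynomial.X (j, k)

variable (G₁ : SimpleGraph (Fin m)) (G₂ : SimpleGraph (Fin n))

/-- The binomial edge ideal `J_{G₁,G₂}` of a pair of graphs. -/
def pairIdeal : Ideal (MvPolynomial (Fin m × Fin n) K) :=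
  Ideal.span {p | ∃ (i j : Fin m) (k l : Fin n),
    i < j ∧ k < l ∧ G₁.Adj i j ∧ G₂.Adj k l ∧ p = minor K i j k l}

/-- The algebra `R = S / J_{G₁,G₂}`. -/
abbrev PairRing : Type _ := MvPolynomial (Fin m × Fin n) K ⧸ pairIdeal K G₁ G₂

/-- The residue classes of the variables in `R`. -/
def pairVar (a : Fin m × Fin n) : PairRing K G₁ G₂ :=
  Ideal.Quotient.mk (pairIdeal K G₁ G₂) (MvPolynomial.X a)

/-- The grading on `R` induced by the standard grading of the polynomial ring by degree. -/
def pairGrading : ℕ → Submodule K (PairRing K G₁ G₂) :=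
  quotientGrading (MvPolynomial.homogeneousSubmodule (Fin m × Fin n) K) (pairIdeal K G₁ G₂)

attribute [local instance] MvPolynomial.gradedAlgebra

theorem pairIdeal_isHomogeneous :
    (pairIdeal K G₁ G₂).IsHomogeneous (MvPolynomial.homogeneousSubmodule (Fin m × Fin n) K) := by
  refine Ideal.homogeneous_span _ _ ?_
  rintro _ ⟨i, j, k, l, -, -, -, -, rfl⟩
  exact ⟨2, ((MvPolynomial.isHomogeneous_X K (i, k)).mul (MvPolynomial.isHomogeneous_X K (j, l))).sub
    ((MvPolynomial.isHomogeneous_X K (i, l)).mul (MvPolynomial.isHomogeneous_X K (j, k)))⟩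

instance pairGradedAlgebra : GradedAlgebra (pairGrading K G₁ G₂) :=
  quotientGradedAlgebra _ (pairIdeal_isHomogeneous K G₁ G₂)

end Pair

end KoszulPairs

end

noncomputable section

namespace KoszulPairs

open MvPolynomial

/-! ### Products of entries of a matrix of rank one -/

section RankOne

variable {α β R : Type*} [CommRing R] {x : α × β → R}

/-! Necessity: the filtration condition for a single `(x_a)` forces `0 : x_a = 0`
(`eq_zero_of_mul_pairVar_eq_zero`). If one graph is not complete, it has an induced path i - j - k,
and the minor on i, k and an edge of the other graph is nonzero but killed by a variable in row (or
column) j.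

Sufficiency: for complete graphs R is the Segre ring, in which a monomial is determined by its row
and column multiplicities. Hence membership in an ideal generated by variables can be tested
monomial by monomial, and `(x_B) : x_a` is again generated by variables (`colon_eq_span`). Removing
the variables of any set one at a time then gives the filtration. -/

theorem exists_prod_eq_mul (hx : ∀ i j k l, x (i, l) * x (k, j) = x (i, j) * x (k, l))
    {s : Multiset (α × β)} {i : α} {j : β} (hi : i ∈ s.map Prod.fst) (hj : j ∈ s.map Prod.snd) :
    ∃ t : Multiset (α × β), (s.map x).prod = x (i, j) * (t.map x).prod ∧
      s.map Prod.fst = i ::ₘ t.map Prod.fst ∧ s.map Prod.snd = j ::ₘ t.map Prod.snd := by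
  classical
  obtain ⟨⟨i', l⟩, hil, rfl⟩ := Multiset.mem_map.1 hi
  obtain ⟨⟨k, j'⟩, hkj, rfl⟩ := Multiset.mem_map.1 hj
  dsimp only at *
  obtain ⟨t, rfl⟩ := Multiset.exists_cons_of_mem hil
  rcases Multiset.mem_cons.1 hkj with h | h
  · obtain ⟨rfl, rfl⟩ := Prod.mk.inj h
    exact ⟨t, by simp⟩
  · obtain ⟨t, rfl⟩ := Multiset.exists_cons_of_mem h
    -- One exchange: the entries (i, l) and (k, j) become (i, j) and (k, l).
    refine ⟨(k, l) ::ₘ t, ?_, by simp, ?_⟩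
    · simp only [Multiset.map_cons, Multiset.prod_cons, ← mul_assoc, hx]
    · simpa using Multiset.cons_swap _ _ _

theorem prod_eq_prod_of_map_eq (hx : ∀ i j k l, x (i, l) * x (k, j) = x (i, j) * x (k, l))
    (s : Multiset (α × β)) : ∀ t : Multiset (α × β), s.map Prod.fst = t.map Prod.fst →
      s.map Prod.snd = t.map Prod.snd → (s.map x).prod = (t.map x).prod := by
  induction s using Multiset.induction_on with
  | empty =>
    intro t h _
    rw [Multiset.map_zero, eq_comm, Multiset.map_eq_zero] at h
    rw [h]
  | cons a s ih =>
    intro t h₁ h₂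
    obtain ⟨t', h, h₁', h₂'⟩ := exists_prod_eq_mul hx (s := t) (i := a.1) (j := a.2)
      (h₁ ▸ by simp) (h₂ ▸ by simp)
    rw [h, Multiset.map_cons, Multiset.prod_cons, ih t']
    · rw [h₁'] at h₁
      simpa using h₁
    · rw [h₂'] at h₂
      simpa using h₂

end RankOne

/-! ### The Segre map -/

section Segre

variable {α β : Type*}

/-- The row and column multiplicities of a multiset of positions in a matrix. -/
def marginals (s : Multiset (α × β)) : α ⊕ β →₀ ℕ :=
  open Classical in
  Finsupp.sumElim (Multiset.toFinsupp (s.map Prod.fst)) (Multiset.toFinsupp (s.map Prod.snd))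

theorem marginals_zero : marginals (0 : Multiset (α × β)) = 0 := by
  ext (i | j) <;> simp [marginals]

theorem marginals_cons (a : α × β) (s : Multiset (α × β)) :
    marginals (a ::ₘ s) =
      Finsupp.single (Sum.inl a.1) 1 + Finsupp.single (Sum.inr a.2) 1 + marginals s := by
  classical
  ext (i | j) <;>
    simp [marginals, Multiset.count_cons, Finsupp.single_apply, add_comm, eq_comm]

theorem map_fst_eq_of_marginals_eq {s t : Multiset (α × β)} (h : marginals s = marginals t) :
    s.map Prod.fst = t.map Prod.fst := by
  classical
  ext i
  simpa [marginals] using DFunLike.congr_fun h (Sum.inl i)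

theorem map_snd_eq_of_marginals_eq {s t : Multiset (α × β)} (h : marginals s = marginals t) :
    s.map Prod.snd = t.map Prod.snd := by
  classical
  ext j
  simpa [marginals] using DFunLike.congr_fun h (Sum.inr j)

theorem mem_map_fst_of_marginals_ne_zero {s : Multiset (α × β)} {i : α}
    (h : marginals s (Sum.inl i) ≠ 0) : i ∈ s.map Prod.fst := by
  classical
  exact Multiset.count_ne_zero.1 (by simpa [marginals] using h)

theorem mem_map_snd_of_marginals_ne_zero {s : Multiset (α × β)} {j : β}
    (h : marginals s (Sum.inr j) ≠ 0) : j ∈ s.map Prod.snd := by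
  classical
  exact Multiset.count_ne_zero.1 (by simpa [marginals] using h)

variable (K : Type*) [Field K]

/-- The homomorphism `x i j ↦ s i * t j`. -/
def segreMap : MvPolynomial (α × β) K →ₐ[K] MvPolynomial (α ⊕ β) K :=
  aeval fun a => X (Sum.inl a.1) * X (Sum.inr a.2)

theorem segreMap_X (a : α × β) : segreMap K (X a) =
    monomial (Finsupp.single (Sum.inl a.1) 1 + Finsupp.single (Sum.inr a.2) 1) 1 := by
  rw [segreMap, aeval_X, X, X, monomial_mul, one_mul]

theorem segreMap_prod (s : Multiset (α × β)) :
    segreMap K (s.map X).prod = monomial (marginals s) 1 := by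
  induction s using Multiset.induction_on with
  | empty => simp [marginals_zero]
  | cons a s ih =>
    rw [Multiset.map_cons, Multiset.prod_cons, map_mul, ih, segreMap_X, monomial_mul,
      marginals_cons, one_mul]

variable {K} {R : Type*} [CommRing R] [Algebra K R]

/-- The linear map sending a monomial in the image of the Segre map to the product of the
corresponding entries of `x`, and all other monomials to zero. -/
def segreSection (x : α × β → R) : MvPolynomial (α ⊕ β) K →ₗ[K] R :=
  open Classical in
  (basisMonomials (α ⊕ β) K).constr K fun u =>
    if h : ∃ s : Multiset (α × β), marginals s = u then (h.choose.map x).prod else 0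

theorem segreSection_monomial_mem {x : α × β → R} {u : α ⊕ β →₀ ℕ} {I : Ideal R}
    (h : ∀ s : Multiset (α × β), marginals s = u → (s.map x).prod ∈ I) :
    segreSection (K := K) x (monomial u 1) ∈ I := by
  classical
  rw [segreSection, ← congrFun (coe_basisMonomials (α ⊕ β) K) _, Module.Basis.constr_basis]
  split_ifs with hu
  · exact h _ hu.choose_spec
  · exact I.zero_mem

theorem segreSection_marginals {x : α × β → R}
    (hx : ∀ i j k l, x (i, l) * x (k, j) = x (i, j) * x (k, l)) (s : Multiset (α × β)) :
    segreSection (K := K) x (monomial (marginals s) 1) = (s.map x).prod := by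
  classical
  rw [segreSection, ← congrFun (coe_basisMonomials (α ⊕ β) K) _, Module.Basis.constr_basis]
  have h : ∃ t : Multiset (α × β), marginals t = marginals s := ⟨s, rfl⟩
  rw [dif_pos h]
  exact prod_eq_prod_of_map_eq hx _ _ (map_fst_eq_of_marginals_eq h.choose_spec)
    (map_snd_eq_of_marginals_eq h.choose_spec)

/-- Since evaluation at `x` factors through `segreMap`, the 2-minors account for the whole kernel of
the Segre map. -/
theorem segreSection_segreMap {x : α × β → R}
    (hx : ∀ i j k l, x (i, l) * x (k, j) = x (i, j) * x (k, l)) (p : MvPolynomial (α × β) K) :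
    segreSection x (segreMap K p) = aeval x p := by
  suffices h : segreSection x ∘ₗ (segreMap K).toLinearMap = (aeval x).toLinearMap from
    LinearMap.congr_fun h p
  refine (basisMonomials (α × β) K).ext fun γ => ?_
  have hγ : basisMonomials (α × β) K γ = ((Finsupp.toMultiset γ).map X).prod := by
    rw [coe_basisMonomials]
    change monomial γ 1 = _
    rw [Finsupp.toMultiset_map, Finsupp.prod_toMultiset, monomial_eq, C_1, one_mul,
      Finsupp.prod_mapDomain_index (by simp) (by simp [pow_add])]
  rw [hγ, LinearMap.comp_apply, AlgHom.toLinearMap_apply, segreMap_prod,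
    segreSection_marginals hx, AlgHom.toLinearMap_apply, map_multiset_prod, Multiset.map_map]
  simp

/-- The value is a linear combination of products indexed by the support of the Segre image;
cancellation there has already taken place. -/
theorem aeval_mem_of_segreMap {x : α × β → R}
    (hx : ∀ i j k l, x (i, l) * x (k, j) = x (i, j) * x (k, l)) {p : MvPolynomial (α × β) K}
    {I : Ideal R} (h : ∀ s : Multiset (α × β), marginals s ∈ (segreMap K p).support →
      (s.map x).prod ∈ I) : aeval x p ∈ I := by
  rw [← segreSection_segreMap hx, (segreMap K p).as_sum, map_sum]
  refine I.sum_mem fun u hu => ?_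
  rw [← mul_one (coeff u _), ← smul_eq_mul, ← smul_monomial, map_smul]
  exact Submodule.smul_of_tower_mem I _
    (segreSection_monomial_mem fun s hs => h s (hs ▸ hu))

end Segre

/-! ### The pair ring: evaluation points, and necessity of completeness -/

section Pair

variable {K : Type*} [Field K] {m n : ℕ} {G₁ : SimpleGraph (Fin m)} {G₂ : SimpleGraph (Fin n)}

attribute [local instance] MvPolynomial.gradedAlgebra

theorem minor_mem_pairIdeal {i j : Fin m} {k l : Fin n} (hij : G₁.Adj i j) (hkl : G₂.Adj k l) :
    minor K i j k l ∈ pairIdeal K G₁ G₂ := by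
  have key : ∀ {i j : Fin m} {k l : Fin n}, i < j → G₁.Adj i j → G₂.Adj k l →
      minor K i j k l ∈ pairIdeal K G₁ G₂ := by
    intro i j k l h hij hkl
    rcases lt_or_gt_of_ne hkl.ne with h' | h'
    · exact Ideal.subset_span ⟨i, j, k, l, h, h', hij, hkl, rfl⟩
    · have : minor K i j k l = -minor K i j l k := by simp only [minor]; ring
      rw [this]
      exact neg_mem (Ideal.subset_span ⟨i, j, l, k, h, h', hij, hkl.symm, rfl⟩)
  rcases lt_or_gt_of_ne hij.ne with h | h
  · exact key h hij hkl
  · have : minor K i j k l = -minor K j i k l := by simp only [minor]; ring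
    rw [this]
    exact neg_mem (key h hij.symm hkl)

theorem pairVar_mul_pairVar {i j : Fin m} {k l : Fin n} (hij : G₁.Adj i j) (hkl : G₂.Adj k l) :
    pairVar K G₁ G₂ (i, k) * pairVar K G₁ G₂ (j, l) =
      pairVar K G₁ G₂ (i, l) * pairVar K G₁ G₂ (j, k) := by
  simp only [pairVar, ← map_mul]
  exact Ideal.Quotient.eq.2 (minor_mem_pairIdeal hij hkl)

/-- Substitution of values satisfying the defining equations for the variables. -/
def pairLift {A : Type*} [CommRing A] [Algebra K A] (v : Fin m × Fin n → A)
    (hv : ∀ i j k l, G₁.Adj i j → G₂.Adj k l → v (i, k) * v (j, l) = v (i, l) * v (j, k)) :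
    PairRing K G₁ G₂ →ₐ[K] A :=
  Ideal.Quotient.liftₐ (pairIdeal K G₁ G₂) (aeval v) (by
    suffices h : pairIdeal K G₁ G₂ ≤ RingHom.ker (aeval v : MvPolynomial (Fin m × Fin n) K →ₐ[K] A)
      from fun a ha => h ha
    rw [pairIdeal, Ideal.span_le]
    rintro _ ⟨i, j, k, l, -, -, hij, hkl, rfl⟩
    simp [RingHom.mem_ker, minor, hv i j k l hij hkl])

theorem pairLift_pairVar {A : Type*} [CommRing A] [Algebra K A] (v : Fin m × Fin n → A)
    (hv : ∀ i j k l, G₁.Adj i j → G₂.Adj k l → v (i, k) * v (j, l) = v (i, l) * v (j, k))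
    (a : Fin m × Fin n) : pairLift v hv (pairVar K G₁ G₂ a) = v a := by
  change aeval v (X a) = v a
  simp

/-- Evaluate at the matrix whose only nonzero entry is at `a`: it satisfies every relation and kills
all variables of `A`. -/
theorem pairVar_notMem_span {a : Fin m × Fin n} {A : Set (Fin m × Fin n)} (ha : a ∉ A) :
    pairVar K G₁ G₂ a ∉ Ideal.span (pairVar K G₁ G₂ '' A) := by
  classical
  let v : Fin m × Fin n → K := Pi.single a 1
  have hv : ∀ i j k l, G₁.Adj i j → G₂.Adj k l →
      v (i, k) * v (j, l) = v (i, l) * v (j, k) := by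
    intro i j k l hij hkl
    have h : ∀ b c, b ≠ c → v b * v c = 0 := by
      intro b c hbc
      by_cases hb : b = a
      · simp [v, Pi.single_eq_of_ne (hb ▸ hbc.symm : c ≠ a)]
      · simp [v, Pi.single_eq_of_ne hb]
    rw [h _ _ (by simp [hij.ne]), h _ _ (by simp [hij.ne])]
  intro h
  have h' : Ideal.span (pairVar K G₁ G₂ '' A) ≤ RingHom.ker (pairLift v hv) := by
    rw [Ideal.span_le]
    rintro _ ⟨b, hb, rfl⟩
    rw [SetLike.mem_coe, RingHom.mem_ker, pairLift_pairVar]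
    exact Pi.single_eq_of_ne (ne_of_mem_of_not_mem hb ha) _
  have := h' h
  rw [RingHom.mem_ker, pairLift_pairVar] at this
  simp [v] at this

theorem one_notMem_span (A : Set (Fin m × Fin n)) :
    (1 : PairRing K G₁ G₂) ∉ Ideal.span (pairVar K G₁ G₂ '' A) := by
  intro h
  have h' : Ideal.span (pairVar K G₁ G₂ '' A) ≤
      RingHom.ker (pairLift (G₁ := G₁) (G₂ := G₂) (fun _ => (0 : K)) (by simp)) := by
    rw [Ideal.span_le]
    rintro _ ⟨b, hb, rfl⟩
    rw [SetLike.mem_coe, RingHom.mem_ker, pairLift_pairVar]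
  have := h' h
  simp [RingHom.mem_ker] at this

theorem pairVar_mul_pairVar_ne_zero (a b : Fin m × Fin n) :
    pairVar K G₁ G₂ a * pairVar K G₁ G₂ b ≠ 0 := by
  intro h
  have := congrArg (pairLift (G₁ := G₁) (G₂ := G₂) (fun _ => (1 : K)) (by simp)) h
  simp [pairLift_pairVar] at this

/-- In a c-universally Koszul pair ring, the variables are nonzerodivisors. -/
theorem eq_zero_of_mul_pairVar_eq_zero
    (h : IsCUniversallyKoszul (pairGrading K G₁ G₂) (pairVar K G₁ G₂))
    {a : Fin m × Fin n} {f : PairRing K G₁ G₂} (hf : f * pairVar K G₁ G₂ a = 0) : f = 0 := by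
  obtain ⟨_, ⟨A, rfl⟩, hle, -, ⟨B, hB⟩⟩ := h.exists_cyclic (Ideal.span (pairVar K G₁ G₂ '' {a}))
    ⟨{a}, rfl⟩ (fun h0 => by
      rw [Set.image_singleton, Ideal.span_singleton_eq_bot] at h0
      exact pairVar_mul_pairVar_ne_zero a a (by rw [h0, zero_mul]))
  -- Otherwise J = I and the colon ideal is the unit ideal, which no set of variables generates.
  have hA : A = ∅ := by
    rw [Set.eq_empty_iff_forall_notMem]
    intro b hb
    have hba : b = a := by
      by_contra hne
      exact pairVar_notMem_span (A := {a}) (by simpa using hne)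
        (hle (Ideal.subset_span ⟨b, hb, rfl⟩))
    subst hba
    refine one_notMem_span (K := K) (G₁ := G₁) (G₂ := G₂) B ?_
    rw [← hB, Submodule.mem_colon]
    intro s hs
    rw [one_smul]
    exact Ideal.span_mono (Set.image_mono (by simpa using hb)) hs
  subst hA
  -- A variable in `B` would annihilate `x_a`, but a product of two variables is 1 at the all-ones
  -- matrix.
  have hB0 : B = ∅ := by
    rw [Set.eq_empty_iff_forall_notMem]
    intro b hb
    have hb' : pairVar K G₁ G₂ b ∈ Ideal.span (pairVar K G₁ G₂ '' B) :=
      Ideal.subset_span ⟨b, hb, rfl⟩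
    rw [← hB, Submodule.mem_colon] at hb'
    have := hb' (pairVar K G₁ G₂ a) (Ideal.subset_span (by simp))
    rw [Set.image_empty, Ideal.span_empty, smul_eq_mul, Ideal.mem_bot] at this
    exact pairVar_mul_pairVar_ne_zero _ _ this
  have : f ∈ Ideal.span (pairVar K G₁ G₂ '' B) := by
    rw [← hB, Ideal.span, Submodule.colon_span, Set.image_singleton,
      Submodule.mem_colon_singleton, smul_eq_mul, hf]
    exact zero_mem _
  simpa [hB0] using this

theorem mk_minor (i j : Fin m) (k l : Fin n) :
    Ideal.Quotient.mk (pairIdeal K G₁ G₂) (minor K i j k l) =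
      pairVar K G₁ G₂ (i, k) * pairVar K G₁ G₂ (j, l) -
        pairVar K G₁ G₂ (i, l) * pairVar K G₁ G₂ (j, k) := by
  simp [minor, pairVar]

/-- At the matrix with ones exactly at (i, k) and (j, l), both terms of each generator vanish,
whereas this minor is 1. -/
theorem minor_notMem_pairIdeal {i j : Fin m} {k l : Fin n} (hij : i ≠ j) (hkl : k ≠ l)
    (h : ¬ G₁.Adj i j ∨ ¬ G₂.Adj k l) : minor K i j k l ∉ pairIdeal K G₁ G₂ := by
  classical
  let v : Fin m × Fin n → K := fun a => if a = (i, k) ∨ a = (j, l) then 1 else 0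
  have hzero : ∀ i' j' k' l', G₁.Adj i' j' → G₂.Adj k' l' → v (i', k') * v (j', l') = 0 := by
    intro i' j' k' l' h₁ h₂
    have := h₁.symm
    have := h₂.symm
    have := h₁.ne
    have := h₂.ne
    simp only [v, Prod.mk.injEq]
    split_ifs <;> grind
  have hv : ∀ i' j' k' l', G₁.Adj i' j' → G₂.Adj k' l' →
      v (i', k') * v (j', l') = v (i', l') * v (j', k') := by
    intro i' j' k' l' h₁ h₂
    rw [hzero _ _ _ _ h₁ h₂, hzero _ _ _ _ h₁ h₂.symm]
  intro hmem
  have := congrArg (pairLift v hv) (Ideal.Quotient.eq_zero_iff_mem.2 hmem)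
  rw [mk_minor] at this
  simp [pairLift_pairVar, v, hij, hij.symm, hkl, hkl.symm] at this

theorem exists_induced_path {V : Type*} {G : SimpleGraph V} (hG : G.Connected) (h : G ≠ ⊤) :
    ∃ i j k, G.Adj i j ∧ G.Adj j k ∧ ¬ G.Adj i k ∧ i ≠ k := by
  obtain ⟨u, v, huv, hadj⟩ : ∃ u v, u ≠ v ∧ ¬ G.Adj u v := by
    by_contra! hc
    exact h (SimpleGraph.ext (by ext u v; exact ⟨fun h => h.ne, hc u v⟩))
  -- A shortest walk of length at least 2 has no shortcut between vertices two steps apart.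
  obtain ⟨p, hp⟩ := hG.exists_walk_length_eq_dist u v
  exact SimpleGraph.Walk.exists_adj_adj_not_adj_ne hp
    ((hG.preconnected u v).one_lt_dist_of_ne_of_not_adj huv hadj)

theorem fst_eq_top_of_isCUniversallyKoszul
    (h : IsCUniversallyKoszul (pairGrading K G₁ G₂) (pairVar K G₁ G₂))
    (hG₁ : G₁.Connected) {a b : Fin n} (hab : G₂.Adj a b) : G₁ = ⊤ := by
  by_contra hne
  obtain ⟨i, j, k, hij, hjk, hik, hne⟩ := exists_induced_path hG₁ hne
  refine minor_notMem_pairIdeal (K := K) hne hab.ne (Or.inl hik) (Ideal.Quotient.eq_zero_iff_mem.1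
    (eq_zero_of_mul_pairVar_eq_zero h (a := (j, a)) ?_))
  rw [mk_minor]
  linear_combination pairVar K G₁ G₂ (i, a) * pairVar_mul_pairVar (K := K) hjk hab +
    pairVar K G₁ G₂ (k, a) * pairVar_mul_pairVar (K := K) hij hab

theorem snd_eq_top_of_isCUniversallyKoszul
    (h : IsCUniversallyKoszul (pairGrading K G₁ G₂) (pairVar K G₁ G₂))
    (hG₂ : G₂.Connected) {a b : Fin m} (hab : G₁.Adj a b) : G₂ = ⊤ := by
  by_contra hne
  obtain ⟨i, j, k, hij, hjk, hik, hne⟩ := exists_induced_path hG₂ hne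
  refine minor_notMem_pairIdeal (K := K) hab.ne hne (Or.inr hik) (Ideal.Quotient.eq_zero_iff_mem.1
    (eq_zero_of_mul_pairVar_eq_zero h (a := (a, j)) ?_))
  rw [mk_minor]
  linear_combination pairVar K G₁ G₂ (a, i) * pairVar_mul_pairVar (K := K) hab hjk +
    pairVar K G₁ G₂ (a, k) * pairVar_mul_pairVar (K := K) hab hij

/-! ### The complete case -/

theorem pairVar_mul_pairVar_top (i k : Fin m) (j l : Fin n) :
    pairVar K ⊤ ⊤ (i, l) * pairVar K ⊤ ⊤ (k, j) =
      pairVar K ⊤ ⊤ (i, j) * pairVar K ⊤ ⊤ (k, l) := by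
  by_cases hik : i = k
  · subst hik
    exact mul_comm _ _
  by_cases hjl : l = j
  · subst hjl
    rfl
  exact pairVar_mul_pairVar (by simpa using hik) (by simpa using hjl)

theorem aeval_pairVar (p : MvPolynomial (Fin m × Fin n) K) :
    aeval (pairVar K G₁ G₂) p = Ideal.Quotient.mk (pairIdeal K G₁ G₂) p := by
  have : aeval (pairVar K G₁ G₂) = Ideal.Quotient.mkₐ K (pairIdeal K G₁ G₂) :=
    algHom_ext fun a => by simp [pairVar]
  exact DFunLike.congr_fun this p

/-- Comparison of supports after the Segre map. -/
theorem exists_le_of_mul_mem_span {B : Set (Fin m × Fin n)} {a : Fin m × Fin n}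
    {p : MvPolynomial (Fin m × Fin n) K}
    (h : Ideal.Quotient.mk (pairIdeal K ⊤ ⊤) p * pairVar K ⊤ ⊤ a ∈
      Ideal.span (pairVar K ⊤ ⊤ '' B)) {u : Fin m ⊕ Fin n →₀ ℕ}
    (hu : u ∈ (segreMap K p).support) :
    ∃ b ∈ B, Finsupp.single (Sum.inl b.1) 1 + Finsupp.single (Sum.inr b.2) 1 ≤
      u + (Finsupp.single (Sum.inl a.1) 1 + Finsupp.single (Sum.inr a.2) 1) := by
  let e : Fin m × Fin n → (Fin m ⊕ Fin n →₀ ℕ) := fun b =>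
    Finsupp.single (Sum.inl b.1) 1 + Finsupp.single (Sum.inr b.2) 1
  let v : Fin m × Fin n → MvPolynomial (Fin m ⊕ Fin n) K := fun b => monomial (e b) 1
  let φ : PairRing K (⊤ : SimpleGraph (Fin m)) (⊤ : SimpleGraph (Fin n)) →ₐ[K] _ := pairLift v
    (fun i j k l _ _ => by
      simp only [v, e, monomial_mul]
      exact congrArg (fun u => monomial u _) (by abel))
  have hφ : ∀ q, φ (Ideal.Quotient.mk _ q) = segreMap K q := by
    intro q
    change aeval v q = _
    congr 1
    exact algHom_ext fun b => by rw [segreMap_X, aeval_X]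
  have h1 := Ideal.mem_map_of_mem φ h
  rw [map_mul, hφ, pairLift_pairVar, Ideal.map_span, ← Set.image_comp] at h1
  have h2 : φ ∘ pairVar K ⊤ ⊤ = (fun s => monomial s (1 : K)) ∘ e :=
    funext fun b => pairLift_pairVar _ _ b
  -- In the target polynomial ring the ideal is monomial, so divisibility can be read off each
  -- exponent.
  rw [h2, Set.image_comp, mem_ideal_span_monomial_image] at h1
  obtain ⟨_, ⟨b, hb, rfl⟩, hle⟩ := h1 (u + e a) (by
    rw [mem_support_iff, coeff_mul_monomial, mul_one]
    exact mem_support_iff.1 hu)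
  exact ⟨b, hb, hle⟩

theorem pairVar_dvd_prod {s : Multiset (Fin m × Fin n)} {b : Fin m × Fin n}
    (h₁ : b.1 ∈ s.map Prod.fst) (h₂ : b.2 ∈ s.map Prod.snd) :
    pairVar K ⊤ ⊤ b ∣ (s.map (pairVar K ⊤ ⊤)).prod := by
  obtain ⟨t, ht, -⟩ := exists_prod_eq_mul
    (fun i j k l => pairVar_mul_pairVar_top (K := K) i k j l) h₁ h₂
  exact ⟨_, ht⟩

/-- If some `x_b` with `b ∈ B` divides a monomial times `x_a` after the Segre map, the monomial
already has a variable factor `x_c` with `x_c x_a ∈ (x_B)`. -/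
theorem colon_eq_span {B : Set (Fin m × Fin n)} {a : Fin m × Fin n} (ha : a ∉ B) :
    (Ideal.span (pairVar K ⊤ ⊤ '' B)).colon {pairVar K ⊤ ⊤ a} =
      Ideal.span (pairVar K ⊤ ⊤ '' {c | pairVar K ⊤ ⊤ c * pairVar K ⊤ ⊤ a ∈
        Ideal.span (pairVar K ⊤ ⊤ '' B)}) := by
  apply le_antisymm
  · intro f hf
    obtain ⟨p, rfl⟩ := Ideal.Quotient.mk_surjective f
    rw [Submodule.mem_colon_singleton, smul_eq_mul] at hf
    rw [← aeval_pairVar]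
    refine aeval_mem_of_segreMap (fun i j k l => pairVar_mul_pairVar_top i k j l) fun s hs => ?_
    obtain ⟨b, hb, hle⟩ := exists_le_of_mul_mem_span hf hs
    obtain ⟨i, j⟩ := b
    obtain ⟨p', q⟩ := a
    have hvar := Ideal.subset_span (α := PairRing K ⊤ ⊤) (Set.mem_image_of_mem (pairVar K ⊤ ⊤) hb)
    have hi : i ≠ p' → i ∈ s.map Prod.fst := fun hip => by
      refine mem_map_fst_of_marginals_ne_zero fun h0 => ?_
      have := hle (Sum.inl i)
      simp [h0, Ne.symm hip] at this
    have hj : j ≠ q → j ∈ s.map Prod.snd := fun hjq => by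
      refine mem_map_snd_of_marginals_ne_zero fun h0 => ?_
      have := hle (Sum.inr j)
      simp [h0, Ne.symm hjq] at this
    -- If b shares a row with a, choose an entry c of `s` in the column of b: exchanging columns
    -- makes `x_c x_a` a multiple of `x_b`. A shared column is symmetric; if neither is shared, take
    -- c = b.
    obtain ⟨c, hc₁, hc₂, hc⟩ : ∃ c : Fin m × Fin n, c.1 ∈ s.map Prod.fst ∧
        c.2 ∈ s.map Prod.snd ∧ pairVar K ⊤ ⊤ c * pairVar K ⊤ ⊤ (p', q) ∈
          Ideal.span (pairVar K ⊤ ⊤ '' B) := by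
      by_cases hip : i = p'
      · subst hip
        have hjq : j ≠ q := fun h => ha (h ▸ hb)
        obtain ⟨c, hc, rfl⟩ := Multiset.mem_map.1 (hj hjq)
        refine ⟨c, Multiset.mem_map_of_mem _ hc, Multiset.mem_map_of_mem _ hc, ?_⟩
        rw [← Prod.mk.eta (p := c), ← pairVar_mul_pairVar_top]
        exact Ideal.mul_mem_left _ _ hvar
      · by_cases hjq : j = q
        · subst hjq
          obtain ⟨c, hc, rfl⟩ := Multiset.mem_map.1 (hi hip)
          refine ⟨c, Multiset.mem_map_of_mem _ hc, Multiset.mem_map_of_mem _ hc, ?_⟩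
          rw [← Prod.mk.eta (p := c), pairVar_mul_pairVar_top]
          exact Ideal.mul_mem_right _ _ hvar
        · exact ⟨(i, j), hi hip, hj hjq, Ideal.mul_mem_right _ _ hvar⟩
    exact Ideal.mem_of_dvd _ (pairVar_dvd_prod hc₁ hc₂)
      (Ideal.subset_span (Set.mem_image_of_mem _ hc))
  · rw [Ideal.span_le]
    rintro _ ⟨c, hc, rfl⟩
    rw [SetLike.mem_coe, Submodule.mem_colon_singleton]
    exact hc

theorem pairVar_mem_pairGrading (a : Fin m × Fin n) :
    pairVar K G₁ G₂ a ∈ pairGrading K G₁ G₂ 1 :=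
  ⟨X a, isHomogeneous_X K a, rfl⟩

theorem irrelevant_eq_span_range :
    (HomogeneousIdeal.irrelevant (pairGrading K G₁ G₂)).toIdeal =
      Ideal.span (Set.range (pairVar K G₁ G₂)) := by
  have hle : Ideal.span (Set.range (pairVar K G₁ G₂)) ≤
      (HomogeneousIdeal.irrelevant (pairGrading K G₁ G₂)).toIdeal := by
    rw [Ideal.span_le]
    rintro _ ⟨a, rfl⟩
    exact HomogeneousIdeal.mem_irrelevant_of_mem _ one_pos (pairVar_mem_pairGrading a)
  refine le_antisymm ?_ hle
  rw [HomogeneousIdeal.irrelevant_eq_span, Ideal.span_le]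
  intro f hf
  simp only [Set.mem_iUnion] at hf
  obtain ⟨d, hd, p, hp, rfl⟩ := hf
  have hp' : p ∈ Ideal.span (X '' (Set.univ : Set (Fin m × Fin n))) := by
    rw [mem_ideal_span_X_image]
    intro u hu
    by_contra! hc
    have hu0 : u = 0 := Finsupp.ext fun a => hc a trivial
    have := (mem_homogeneousSubmodule d p).1 hp (mem_support_iff.1 hu)
    simp [hu0] at this
    omega
  have := Ideal.mem_map_of_mem (Ideal.Quotient.mk (pairIdeal K G₁ G₂)) hp'
  rwa [Ideal.map_span, Set.image_univ, ← Set.range_comp] at this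

theorem isPrincipal_quotient_span_insert {R : Type*} [CommRing R] (r : R) (s : Set R) :
    Module.IsPrincipal R
      (Ideal.span (insert r s) ⧸ (Ideal.span s).submoduleOf (Ideal.span (insert r s))) := by
  refine ⟨Submodule.Quotient.mk ⟨r, Ideal.subset_span (Set.mem_insert r s)⟩, ?_⟩
  symm
  rw [eq_top_iff]
  rintro y -
  obtain ⟨⟨y, hy⟩, rfl⟩ := Submodule.Quotient.mk_surjective _ y
  obtain ⟨c, z, hz, rfl⟩ := Ideal.mem_span_insert.1 hy
  refine Submodule.mem_span_singleton.2 ⟨c, ?_⟩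
  rw [← Submodule.Quotient.mk_smul, Submodule.Quotient.eq]
  change c * r - (c * r + z) ∈ Ideal.span s
  simpa using hz

theorem isCUniversallyKoszul_top :
    IsCUniversallyKoszul (pairGrading K (⊤ : SimpleGraph (Fin m)) (⊤ : SimpleGraph (Fin n)))
      (pairVar K ⊤ ⊤) where
  generated_by_linear_forms := by
    rintro _ ⟨A, rfl⟩
    refine ⟨_, ?_, rfl⟩
    rintro _ ⟨a, -, rfl⟩
    exact pairVar_mem_pairGrading a
  zero_mem := ⟨∅, by simp⟩
  maximal_mem := ⟨Set.univ, by rw [Set.image_univ, irrelevant_eq_span_range]⟩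
  exists_cyclic := by
    rintro _ ⟨A, rfl⟩ hne
    obtain ⟨a, ha⟩ : A.Nonempty := by
      rw [Set.nonempty_iff_ne_empty]
      rintro rfl
      simp at hne
    have hA : pairVar K ⊤ ⊤ '' A = insert (pairVar K ⊤ ⊤ a) (pairVar K ⊤ ⊤ '' (A \ {a})) := by
      rw [← Set.image_insert_eq, Set.insert_sdiff_singleton, Set.insert_eq_of_mem ha]
    refine ⟨Ideal.span (pairVar K ⊤ ⊤ '' (A \ {a})), ⟨_, rfl⟩,
      Ideal.span_mono (Set.image_mono Set.sdiff_subset), ?_,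
      {c | pairVar K ⊤ ⊤ c * pairVar K ⊤ ⊤ a ∈ Ideal.span (pairVar K ⊤ ⊤ '' (A \ {a}))}, ?_⟩
    · rw [hA]
      exact isPrincipal_quotient_span_insert _ _
    -- Only the removed generator matters: the remaining ones lie in J and contribute the unit ideal
    -- to the intersection.
    · rw [← colon_eq_span (by simp), hA, Ideal.span, Submodule.colon_span, Set.insert_eq,
        Submodule.colon_union, inf_eq_left]
      exact le_top.trans (Submodule.colon_eq_top_iff_subset _ |>.2 Submodule.subset_span).ge

end Pair

end KoszulPairs

theorem proposition3p6 {K : Type*} [Field K] (m n : ℕ) (hm : 3 ≤ m) (hn : 3 ≤ n)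
    (G₁ : SimpleGraph (Fin m)) (G₂ : SimpleGraph (Fin n))
    (hG₁ : G₁.Connected) (hG₂ : G₂.Connected) :
    KoszulPairs.IsCUniversallyKoszul (KoszulPairs.pairGrading K G₁ G₂)
        (KoszulPairs.pairVar K G₁ G₂) ↔
      G₁ = ⊤ ∧ G₂ = ⊤ := by
  constructor
  · intro h
    have : Nontrivial (Fin m) := Fin.nontrivial_iff_two_le.2 (by omega)
    have : Nontrivial (Fin n) := Fin.nontrivial_iff_two_le.2 (by omega)
    -- Completeness of each graph is derived using an edge of the other.
    obtain ⟨b, hb⟩ := hG₁.preconnected.exists_adj_of_nontrivial ⟨0, by omega⟩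
    obtain ⟨c, hc⟩ := hG₂.preconnected.exists_adj_of_nontrivial ⟨0, by omega⟩
    exact ⟨KoszulPairs.fst_eq_top_of_isCUniversallyKoszul h hG₁ hc,
      KoszulPairs.snd_eq_top_of_isCUniversallyKoszul h hG₂ hb⟩
  · rintro ⟨rfl, rfl⟩
    exact KoszulPairs.isCUniversallyKoszul_top

end
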